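/- Let $g\ge 0$ and let $\lambda_1,\dots,\lambda_{2g+2}\in\mathbb{C}$ be distinct points whose set is symmetric under complex conjugation. Let $\Sigma$ be the compact hyperelliptic Riemann surface of genus $g$ defined by $\mu^2=\prod_{i=1}^{2g+2}(\lambda-\lambda_i)$, with the two points $\infty_\pm$ over $\lambda=\infty$ labelled so that $\lambda^{g+1}/\mu\to\pm1$ at $\infty_\pm$. Let $\iota:(\lambda,\mu)\mapsto(\lambda,-\mu)$ be the sheet interchange (so $\iota(\infty_\pm)=\infty_\mp$) and $\tau:(\lambda,\mu)\mapsto(\overline{\lambda},\overline{\mu})$ complex conjugation on $\Sigma$ (so $\tau(\infty_\pm)=\infty_\pm$). Write $\sim$ for linear equivalence of divisors, and $l(\mathcal{D})$ for the dimension of the space of meromorphic functions $f$ on $\Sigma$ with $f=0$ or $\mathcal{D}+(f)\ge 0$. Let $\mathcal{D}$ be a positive (i.e. effective) divisor on $\Sigma$ of degree $g+1$, not containing $\infty_+$ or $\infty_-$, which is non-special, i.e. $l(\mathcal{D})=\deg\mathcal{D}-g+1$, and which satisfies the Genericity Condition: $\mathcal{D}-\infty_+-\infty_-$ is not linearly equivalent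 to a positive divisor. Then there are unique positive divisors $\mathcal{D}_+\sim\mathcal{D}-\infty_+$ and $\mathcal{D}_-\sim\mathcal{D}-\infty_-$, and $$\mathcal{D}_-=\iota\tau(\mathcal{D}_+)\quad\text{if and only if}\quad \iota\tau(\mathcal{D})\sim\mathcal{D}.$$ -/

import Mathlib

open Filter Topology

/-- Branch points `λ_1, …, λ_{2g+2}` of a hyperelliptic Riemann surface of genus `g`: distinct complex
numbers whose set is symmetric about the real axis. -/
structure RealBranchPoints (g : ℕ) where
  pt : Fin (2 * g + 2) → ℂ
  pt_injective : Function.Injective pt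
  conj_mem : ∀ i, ∃ j, pt j = (starRingEnd ℂ) (pt i)

namespace RealBranchPoints

variable {g : ℕ} (B : RealBranchPoints g)

/-- The polynomial function `∏ (x - λ_i)`. -/
noncomputable def poly (x : ℂ) : ℂ := ∏ i, (x - B.pt i)

open scoped Classical in
/-- The product `∏ (x - λ_i)` over those `i` with `λ_i ≠ a`. -/
noncomputable def cofactor (a x : ℂ) : ℂ := ∏ i with B.pt i ≠ a, (x - B.pt i)

/-- The points of the compact hyperelliptic Riemann surface: the solutions `(x, y) = (λ, μ)` of
`μ ^ 2 = ∏ (λ - λ_i)`, and the two points at infinity. -/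
inductive Surface (B : RealBranchPoints g) : Type
  | affine (x y : ℂ) (h : y ^ 2 = B.poly x) : Surface B
  | infPlus : Surface B
  | infMinus : Surface B

/-- The principal branch of the square root; it is holomorphic near `1`, with value `1` at `1`. -/
noncomputable def csqrt (z : ℂ) : ℂ := z ^ (1 / 2 : ℂ)

theorem csqrt_sq (z : ℂ) : csqrt z ^ 2 = z := by
  unfold csqrt
  rw [one_div]
  exact Complex.cpow_nat_inv_pow z (n := 2) two_ne_zero

theorem poly_eq_zero_iff (a : ℂ) : B.poly a = 0 ↔ ∃ i, B.pt i = a := by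
  simp only [poly, Finset.prod_eq_zero_iff, Finset.mem_univ, true_and, sub_eq_zero]
  exact ⟨fun ⟨i, h⟩ => ⟨i, h.symm⟩, fun ⟨i, h⟩ => ⟨i, h.symm⟩⟩

theorem cofactor_self_ne_zero (a : ℂ) : B.cofactor a a ≠ 0 := by
  classical
  simp only [cofactor, Finset.prod_ne_zero_iff, Finset.mem_filter, Finset.mem_univ, true_and]
  intro i hi h
  exact hi (sub_eq_zero.mp h).symm

theorem poly_eq_mul_cofactor {a : ℂ} (ha : B.poly a = 0) (x : ℂ) :
    B.poly x = (x - a) * B.cofactor a x := by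
  classical
  obtain ⟨i, rfl⟩ := (B.poly_eq_zero_iff a).1 ha
  unfold poly cofactor
  rw [← Finset.mul_prod_erase Finset.univ (fun j => x - B.pt j) (Finset.mem_univ i)]
  congr 1
  refine Finset.prod_congr ?_ fun _ _ => rfl
  ext j
  simp [B.pt_injective.eq_iff]

theorem poly_inv {t : ℂ} (ht : t ≠ 0) :
    B.poly t⁻¹ = (t⁻¹ ^ (g + 1)) ^ 2 * ∏ i, (1 - B.pt i * t) := by
  have h : ∀ i, t⁻¹ - B.pt i = t⁻¹ * (1 - B.pt i * t) := by
    intro i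
    field_simp
  unfold poly
  simp only [h, Finset.prod_mul_distrib, Finset.prod_const, Finset.card_univ, Fintype.card_fin]
  rw [← pow_mul]
  congr 2
  ring

namespace Surface

variable {B}

/-- The local uniformizing parametrization centred at a point `P` of the surface; near `t = 0` it is the
inverse of a holomorphic chart at `P` sending `P` to `0`. The chart is `λ - λ(P)` at a finite point that
is not a branch point, a square root of `λ - λ(P)` at a branch point, and `1 / λ` at the points at
infinity, which are labelled so that `λ ^ (g + 1) / μ → ±1` at `∞_±`. -/
noncomputable def localParam : Surface B → ℂ → Surface B
  | affine a b h, t =>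
      open scoped Classical in
      if hb : b = 0 then
        affine (a + t ^ 2)
          (t * csqrt (B.cofactor a a) * csqrt (B.cofactor a (a + t ^ 2) / B.cofactor a a)) (by
            have ha : B.poly a = 0 := by rw [← h, hb]; ring
            have hc := B.cofactor_self_ne_zero a
            rw [mul_pow, mul_pow, csqrt_sq, csqrt_sq, B.poly_eq_mul_cofactor ha]
            field_simp
            ring)
      else
        affine (a + t) (b * csqrt (B.poly (a + t) / B.poly a)) (by
          have ha : B.poly a ≠ 0 := by rw [← h]; exact pow_ne_zero 2 hb
          rw [mul_pow, csqrt_sq, h]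
          field_simp)
  | infPlus, t =>
      open scoped Classical in
      if ht : t = 0 then infPlus
      else affine t⁻¹ (t⁻¹ ^ (g + 1) * csqrt (∏ i, (1 - B.pt i * t))) (by
        rw [mul_pow, csqrt_sq, B.poly_inv ht])
  | infMinus, t =>
      open scoped Classical in
      if ht : t = 0 then infMinus
      else affine t⁻¹ (-(t⁻¹ ^ (g + 1) * csqrt (∏ i, (1 - B.pt i * t)))) (by
        rw [neg_sq, mul_pow, csqrt_sq, B.poly_inv ht])

/-- `F` is a meromorphic function on the surface. As in Mathlib's `MeromorphicAt`, the values of `F` on a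
discrete set of points are irrelevant. -/
def IsMeromorphic (F : Surface B → ℂ) : Prop :=
  ∀ P, MeromorphicAt (fun t => F (localParam P t)) 0

/-- The order of a meromorphic function at `P` (equal to `⊤` when the function vanishes
identically near `P`). -/
noncomputable def ord (F : Surface B → ℂ) (P : Surface B) : WithTop ℤ :=
  meromorphicOrderAt (fun t => F (localParam P t)) 0

/-- The sheet interchange `ι : (λ, μ) ↦ (λ, -μ)`, which swaps the points at infinity. -/
def sheetInterchange : Surface B → Surface B
  | affine x y h => affine x (-y) (by rw [neg_sq, h])
  | infPlus => infMinus
  | infMinus => infPlus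

theorem _root_.RealBranchPoints.poly_conj (B : RealBranchPoints g) (x : ℂ) :
    B.poly ((starRingEnd ℂ) x) = (starRingEnd ℂ) (B.poly x) := by
  choose s hs using B.conj_mem
  have hinj : Function.Injective s := by
    intro i j hij
    apply B.pt_injective
    apply (starRingEnd ℂ).injective
    rw [← hs i, ← hs j, hij]
  have hbij : Function.Bijective s := Finite.injective_iff_bijective.1 hinj
  unfold poly
  rw [map_prod, ← hbij.prod_comp (fun i => (starRingEnd ℂ) x - B.pt i)]
  simp [hs]

/-- Complex conjugation `τ : (λ, μ) ↦ (conj λ, conj μ)`; it fixes `∞_+` and `∞_-`, since it preserves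
the limits `±1` of `λ ^ (g + 1) / μ`. -/
def complexConj : Surface B → Surface B
  | affine x y h => affine ((starRingEnd ℂ) x) ((starRingEnd ℂ) y) (by
      rw [← map_pow, h, B.poly_conj])
  | infPlus => infPlus
  | infMinus => infMinus

end Surface

open Surface

/-- Divisors on the surface: finite formal integer combinations of points. The order `0 ≤ D` is
pointwise, so it says that `D` is positive (effective). -/
abbrev Divisor : Type := Surface B →₀ ℤ

namespace Divisor

variable {B}

/-- The degree of a divisor. -/
noncomputable def degree (D : Divisor B) : ℤ := D.sum fun _ n => n

/-- Linear equivalence: `D - D'` is the divisor of a (not identically zero) meromorphic function. -/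
def LinEquiv (D D' : Divisor B) : Prop :=
  ∃ F : Surface B → ℂ, IsMeromorphic F ∧ ∀ P, ord F P = (((D - D') P : ℤ) : WithTop ℤ)

/-- The functions `F` with `D + (F) ≥ 0`, before identification of functions that agree off a
discrete set. The zero function belongs to it. -/
noncomputable def functionSpace (D : Divisor B) : Submodule ℂ (Surface B → ℂ) where
  carrier := {F | IsMeromorphic F ∧ ∀ P, ((-(D P) : ℤ) : WithTop ℤ) ≤ ord F P}
  zero_mem' := by
    refine ⟨fun P => MeromorphicAt.const 0 0, fun P => ?_⟩
    have : ord (0 : Surface B → ℂ) P = ⊤ := by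
      rw [ord, meromorphicOrderAt_eq_top_iff]
      exact Eventually.of_forall fun _ => rfl
    rw [this]
    exact le_top
  add_mem' := by
    rintro F G ⟨hF, hF'⟩ ⟨hG, hG'⟩
    exact ⟨fun P => (hF P).add (hG P), fun P =>
      (le_min (hF' P) (hG' P)).trans (meromorphicOrderAt_add (hF P) (hG P))⟩
  smul_mem' := by
    rintro c F ⟨hF, hF'⟩
    refine ⟨fun P => (MeromorphicAt.const c 0).mul (hF P), fun P => ?_⟩
    have h : ord (c • F) P =
        meromorphicOrderAt (fun _ : ℂ => c) 0 + ord F P :=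
      meromorphicOrderAt_mul (MeromorphicAt.const c 0) (hF P)
    have hc : 0 ≤ meromorphicOrderAt (fun _ : ℂ => c) (0 : ℂ) :=
      AnalyticAt.meromorphicOrderAt_nonneg analyticAt_const
    rw [h]
    calc ((-(D P) : ℤ) : WithTop ℤ) ≤ ord F P := hF' P
      _ = 0 + ord F P := (zero_add _).symm
      _ ≤ _ := by gcongr

/-- Functions that vanish off a discrete set; they represent the zero meromorphic function. -/
def negligible (B : RealBranchPoints g) : Submodule ℂ (Surface B → ℂ) where
  carrier := {F | ∀ P, ∀ᶠ t in 𝓝[≠] (0 : ℂ), F (localParam P t) = 0}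
  zero_mem' := fun _ => Eventually.of_forall fun _ => rfl
  add_mem' := by
    intro F G hF hG P
    filter_upwards [hF P, hG P] with t h1 h2
    simp [h1, h2]
  smul_mem' := by
    intro c F hF P
    filter_upwards [hF P] with t h1
    simp [h1]

/-- `l(D)`: the dimension of the space of meromorphic functions `F` with `D + (F) ≥ 0`. -/
noncomputable def ell (D : Divisor B) : ℕ :=
  Module.finrank ℂ ((functionSpace D).map (negligible B).mkQ)

/-- A positive divisor `D` of degree at least `g` is non-special when `l(D) = deg D - g + 1`. -/
def IsNonspecial (D : Divisor B) : Prop :=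
  0 ≤ D ∧ (g : ℤ) ≤ D.degree ∧ (D.ell : ℤ) = D.degree - g + 1

/-- The divisors `∞_+` and `∞_-`. -/
noncomputable def atInfPlus (B : RealBranchPoints g) : Divisor B := Finsupp.single infPlus 1

noncomputable def atInfMinus (B : RealBranchPoints g) : Divisor B := Finsupp.single infMinus 1

/-- The divisor `D - ∞_+ - ∞_-` is not linearly equivalent to a positive divisor. -/
def GenericityCondition (D : Divisor B) : Prop :=
  ¬ ∃ E : Divisor B, 0 ≤ E ∧ LinEquiv (D - atInfPlus B - atInfMinus B) E

/-- The image `ιτ(D)` of a divisor under `ι ∘ τ`. -/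
noncomputable def iotaTau (D : Divisor B) : Divisor B :=
  Finsupp.mapDomain (fun P => sheetInterchange (complexConj P)) D

/-- `E` is a positive divisor linearly equivalent to `D - ∞_+`. -/
def IsPlusPart (D E : Divisor B) : Prop := 0 ≤ E ∧ LinEquiv E (D - atInfPlus B)

/-- `E` is a positive divisor linearly equivalent to `D - ∞_-`. -/
def IsMinusPart (D E : Divisor B) : Prop := 0 ≤ E ∧ LinEquiv E (D - atInfMinus B)

end Divisor

end RealBranchPoints

/-! Non-speciality in degree `g + 1` says `l(D) = 2`. As `D` avoids both points at infinity, every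
function in this two-dimensional space has a value at each of them, so some nonzero combination `F`
vanishes at `∞_+`, and `D - ∞_+ + (F)` is a choice of `D_+`; likewise for `D_-`
(`exists_nonneg_linEquiv_sub_single`). Two choices of `D_+` come from two functions in the space of
`D - ∞_+`. Were these independent, a combination would vanish at `∞_-` as well, against genericity;
so they are proportional and have the same divisor (`eq_of_linEquiv`).

Since `ιτ` is antiholomorphic, `conj ∘ F ∘ ιτ` is meromorphic with divisor `ιτ((F))`, so `ιτ`
respects linear equivalence (`LinEquiv.iotaTau`). It swaps `∞_±`, hence `ιτ(D_+) + ∞_- ∼ ιτ(D)`,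
while `D_- + ∞_- ∼ D`. Thus `D_- ∼ ιτ(D_+)` exactly when `ιτ(D) ∼ D`, and uniqueness of `D_-` turns
this equivalence into equality.

Riemann-Roch is not needed. The analytic input is that a nonzero meromorphic function has a divisor
(`ord_eq_top_iff`, `finite_ord_ne_zero`). It is obtained from the charts and the projection to the
`λ`-plane, without a topology on `Surface`. -/

namespace RealBranchPoints

variable {g : ℕ} (B : RealBranchPoints g)

/-! ### Square roots, local parametrizations and changes of chart -/

theorem continuous_poly : Continuous B.poly := by
  unfold poly; fun_prop

theorem continuous_cofactor (a : ℂ) : Continuous (B.cofactor a) := by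
  unfold cofactor; fun_prop

theorem continuous_prod_one_sub : Continuous fun t : ℂ => ∏ i, (1 - B.pt i * t) := by
  fun_prop

theorem continuousAt_csqrt {z : ℂ} (hz : z ∈ Complex.slitPlane) : ContinuousAt csqrt z :=
  continuousAt_cpow_const hz

theorem csqrt_ne_zero {z : ℂ} (hz : z ≠ 0) : csqrt z ≠ 0 := fun h =>
  hz (by rw [← csqrt_sq z, h]; ring)

theorem csqrt_one : csqrt 1 = 1 := by simp [csqrt]

theorem csqrt_conj {z : ℂ} (hz : z ∈ Complex.slitPlane) :
    csqrt ((starRingEnd ℂ) z) = (starRingEnd ℂ) (csqrt z) := by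
  have h := Complex.conj_cpow z (1 / 2) (Complex.slitPlane_arg_ne_pi hz)
  have h2 : (starRingEnd ℂ) (1 / 2 : ℂ) = 1 / 2 := by
    rw [map_div₀, map_one, Complex.conj_ofNat]
  rw [h2] at h
  exact h

/-- Two continuous square roots that agree at a point where they do not vanish agree nearby. -/
theorem eventually_eq_of_sq_eq {u v : ℂ → ℂ} {s : ℂ} (hu : ContinuousAt u s) (hv : ContinuousAt v s)
    (h : u s = v s) (h0 : u s ≠ 0) (hsq : ∀ᶠ t in 𝓝 s, u t ^ 2 = v t ^ 2) : ∀ᶠ t in 𝓝 s, u t = v t := by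
  have h1 : ∀ᶠ t in 𝓝 s, u t + v t ≠ 0 := by
    refine (hu.add hv).eventually_ne (y := 0) ?_
    rw [Pi.add_apply, ← h, ← two_mul]
    exact mul_ne_zero two_ne_zero h0
  filter_upwards [hsq, h1] with t h2 h3
  have : (u t + v t) * (u t - v t) = 0 := by linear_combination h2
  exact sub_eq_zero.1 ((mul_eq_zero.1 this).resolve_left h3)

theorem eventually_slitPlane {f : ℂ → ℂ} {s : ℂ} (hf : ContinuousAt f s) (h : f s = 1) :
    ∀ᶠ t in 𝓝 s, f t ∈ Complex.slitPlane :=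
  hf.eventually_mem (Complex.isOpen_slitPlane.mem_nhds (by rw [h]; exact Complex.one_mem_slitPlane))

namespace Surface

variable {B}

theorem affine_congr {x y x' y' : ℂ} {h : y ^ 2 = B.poly x} (hx : x = x') (hy : y = y') :
    (affine x y h : Surface B) = affine x' y' (by rw [← hx, ← hy, h]) := by
  subst hx hy; rfl

theorem localParam_branch {a b : ℂ} (h : b ^ 2 = B.poly a) (hb : b = 0) (t : ℂ) :
    ∃ h', localParam (affine a b h) t = affine (a + t ^ 2)
      (t * csqrt (B.cofactor a a) * csqrt (B.cofactor a (a + t ^ 2) / B.cofactor a a)) h' := by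
  exact ⟨_, dif_pos hb⟩

theorem localParam_regular {a b : ℂ} (h : b ^ 2 = B.poly a) (hb : b ≠ 0) (t : ℂ) :
    ∃ h', localParam (affine a b h) t = affine (a + t) (b * csqrt (B.poly (a + t) / B.poly a)) h' := by
  exact ⟨_, dif_neg hb⟩

theorem localParam_infPlus {t : ℂ} (ht : t ≠ 0) :
    ∃ h', localParam (infPlus : Surface B) t =
      affine t⁻¹ (t⁻¹ ^ (g + 1) * csqrt (∏ i, (1 - B.pt i * t))) h' := by
  exact ⟨_, dif_neg ht⟩

theorem localParam_infMinus {t : ℂ} (ht : t ≠ 0) :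
    ∃ h', localParam (infMinus : Surface B) t =
      affine t⁻¹ (-(t⁻¹ ^ (g + 1) * csqrt (∏ i, (1 - B.pt i * t)))) h' := by
  exact ⟨_, dif_neg ht⟩

theorem localParam_zero (P : Surface B) : localParam P 0 = P := by
  cases P with
  | affine a b h =>
    by_cases hb : b = 0
    · obtain ⟨h', e⟩ := localParam_branch h hb 0
      rw [e]
      exact affine_congr (by simp) (by simp [hb])
    · obtain ⟨h', e⟩ := localParam_regular h hb 0
      rw [e]
      refine affine_congr (by simp) ?_
      rw [add_zero, div_self (by rw [← h]; exact pow_ne_zero 2 hb), csqrt_one, mul_one]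
  | infPlus => simp [localParam]
  | infMinus => simp [localParam]

theorem poly_ne_zero_of_ne {a b : ℂ} (h : b ^ 2 = B.poly a) (hb : b ≠ 0) : B.poly a ≠ 0 := by
  rw [← h]; exact pow_ne_zero 2 hb

theorem continuousAt_poly_ratio (a s : ℂ) :
    ContinuousAt (fun t => B.poly (a + t) / B.poly a) s :=
  ((B.continuous_poly.comp (continuous_const.add continuous_id)).div_const _).continuousAt

theorem continuousAt_cofactor_ratio (a s : ℂ) :
    ContinuousAt (fun t => B.cofactor a (a + t ^ 2) / B.cofactor a a) s :=
  (((B.continuous_cofactor a).comp (by fun_prop : Continuous fun t : ℂ => a + t ^ 2)).div_const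
    _).continuousAt

theorem eventually_poly_ratio {a : ℂ} (ha : B.poly a ≠ 0) :
    ∀ᶠ t in 𝓝 (0 : ℂ), B.poly (a + t) / B.poly a ∈ Complex.slitPlane :=
  eventually_slitPlane (continuousAt_poly_ratio a 0) (by simp [div_self ha])

theorem eventually_cofactor_ratio (a : ℂ) :
    ∀ᶠ t in 𝓝 (0 : ℂ), B.cofactor a (a + t ^ 2) / B.cofactor a a ∈ Complex.slitPlane :=
  eventually_slitPlane (continuousAt_cofactor_ratio a 0) (by simp [div_self (B.cofactor_self_ne_zero a)])

theorem eventually_prod_one_sub :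
    ∀ᶠ t in 𝓝 (0 : ℂ), ∏ i, (1 - B.pt i * t) ∈ Complex.slitPlane :=
  eventually_slitPlane B.continuous_prod_one_sub.continuousAt (by simp)

/-- Only off the branch points: a branch point is fixed by `ι`, which acts on its chart as `t ↦ -t`.
-/
theorem localParam_sheetInterchange {a b : ℂ} (h : b ^ 2 = B.poly a) (hb : b ≠ 0) (t : ℂ) :
    localParam (sheetInterchange (affine a b h)) t = sheetInterchange (localParam (affine a b h) t) := by
  obtain ⟨h1, e1⟩ := localParam_regular h hb t
  obtain ⟨h2, e2⟩ := localParam_regular (B := B) (a := a) (b := -b) (by rw [neg_sq, h]) (neg_ne_zero.2 hb) t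
  rw [e1]
  simp only [sheetInterchange]
  rw [e2]
  exact affine_congr rfl (by ring)

/-- Near a point, a local parametrization is described by holomorphic coordinates with `λ` a local
coordinate. -/
def IsRegularCurve (c : ℂ → Surface B) (ξ : ℂ → ℂ) (s : ℂ) : Prop :=
  AnalyticAt ℂ ξ s ∧ deriv ξ s ≠ 0 ∧ ∃ η : ℂ → ℂ, ContinuousAt η s ∧ η s ≠ 0 ∧
    ∀ᶠ u in 𝓝 s, ∃ h, c u = affine (ξ u) (η u) h

theorem IsRegularCurve.exists_eq {c : ℂ → Surface B} {ξ : ℂ → ℂ} {s : ℂ} (H : IsRegularCurve c ξ s) :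
    ∃ y h, y ≠ 0 ∧ c s = affine (ξ s) y h := by
  obtain ⟨_, _, η, _, h0, hc⟩ := H
  obtain ⟨h, e⟩ := hc.self_of_nhds
  exact ⟨_, h, h0, e⟩

/-- Along both sides `μ` is a continuous square root of the same function of `u`. The two agree and
are nonzero at `s`, so they agree nearby. -/
theorem IsRegularCurve.eventually_eq_localParam {c : ℂ → Surface B} {ξ : ℂ → ℂ} {s : ℂ}
    (H : IsRegularCurve c ξ s) : ∀ᶠ u in 𝓝 s, c u = localParam (c s) (ξ u - ξ s) := by
  obtain ⟨hξ, _, η, hη, h0, hc⟩ := H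
  obtain ⟨h, e⟩ := hc.self_of_nhds
  have hp := poly_ne_zero_of_ne h h0
  have hcont : ContinuousAt (fun u => η s * csqrt (B.poly (ξ u) / B.poly (ξ s))) s := by
    refine continuousAt_const.mul (ContinuousAt.comp (g := csqrt) (continuousAt_csqrt ?_)
      ((B.continuous_poly.continuousAt.comp hξ.continuousAt).div_const _))
    simp [div_self hp]
  have hEq := eventually_eq_of_sq_eq hη hcont (by simp [div_self hp, csqrt_one]) h0 (by
    filter_upwards [hc] with u ⟨h', _⟩
    rw [mul_pow, csqrt_sq, h', h]
    field_simp)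
  filter_upwards [hc, hEq] with u ⟨h', e'⟩ h2
  rw [e, e']
  obtain ⟨h3, e3⟩ := localParam_regular h h0 (ξ u - ξ s)
  rw [e3]
  refine affine_congr (by ring) ?_
  rw [h2, add_sub_cancel]

/-- The change of chart `u ↦ ξ u - ξ s` has nonzero derivative, so it preserves orders. This lets
the chart at one point compute orders at nearby points. -/
theorem IsRegularCurve.meromorphicOrderAt {c : ℂ → Surface B} {ξ : ℂ → ℂ} {s : ℂ}
    (H : IsRegularCurve c ξ s) (F : Surface B → ℂ) :
    meromorphicOrderAt (fun u => F (c u)) s = ord F (c s) := by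
  have h1 : (fun u => F (c u)) =ᶠ[𝓝 s]
      (fun t => F (localParam (c s) t)) ∘ (fun u => ξ u - ξ s) := by
    filter_upwards [H.eventually_eq_localParam] with u hu
    simp only [Function.comp_apply, ← hu]
  rw [meromorphicOrderAt_congr (h1.filter_mono nhdsWithin_le_nhds),
    meromorphicOrderAt_comp_of_deriv_ne_zero (g := fun u => ξ u - ξ s) (H.1.sub analyticAt_const)
      (by rw [deriv_sub_const]; exact H.2.1), sub_self]
  rfl

/-- The centre is excluded because `λ` fails to be a coordinate at branch points, where it is `a + u
^ 2`, and at infinity, where it is `u⁻¹`. -/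
theorem eventually_isRegularCurve (P : Surface B) :
    ∀ᶠ s in 𝓝[≠] (0 : ℂ), ∃ ξ, IsRegularCurve (localParam P) ξ s := by
  cases P with
  | affine a b h =>
    by_cases hb : b = 0
    · filter_upwards [self_mem_nhdsWithin, (eventually_cofactor_ratio (B := B) a).filter_mono
        nhdsWithin_le_nhds] with s hs hr
      have hs : s ≠ 0 := hs
      refine ⟨fun u => a + u ^ 2, by fun_prop, ?_, fun u => u * csqrt (B.cofactor a a) *
        csqrt (B.cofactor a (a + u ^ 2) / B.cofactor a a), ?_, ?_,
        Eventually.of_forall fun u => localParam_branch h hb u⟩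
      · simp [hs]
      · exact (continuousAt_id.mul continuousAt_const).mul
          (ContinuousAt.comp (g := csqrt) (continuousAt_csqrt hr) (continuousAt_cofactor_ratio a s))
      · exact mul_ne_zero (mul_ne_zero hs (csqrt_ne_zero (B.cofactor_self_ne_zero a)))
          (csqrt_ne_zero (Complex.slitPlane_ne_zero hr))
    · filter_upwards [(eventually_poly_ratio (poly_ne_zero_of_ne h hb)).filter_mono
        nhdsWithin_le_nhds] with s hr
      refine ⟨fun u => a + u, by fun_prop, by simp, fun u => b * csqrt (B.poly (a + u) / B.poly a),
        ?_, ?_, Eventually.of_forall fun u => localParam_regular h hb u⟩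
      · exact continuousAt_const.mul
          (ContinuousAt.comp (g := csqrt) (continuousAt_csqrt hr) (continuousAt_poly_ratio a s))
      · exact mul_ne_zero hb (csqrt_ne_zero (Complex.slitPlane_ne_zero hr))
  | infPlus =>
    filter_upwards [self_mem_nhdsWithin, (eventually_prod_one_sub (B := B)).filter_mono
      nhdsWithin_le_nhds] with s hs hr
    have hs : s ≠ 0 := hs
    refine ⟨fun u => u⁻¹, analyticAt_inv hs, by simp [hs],
      fun t => t⁻¹ ^ (g + 1) * csqrt (∏ i, (1 - B.pt i * t)), ?_, ?_, ?_⟩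
    · exact ((continuousAt_inv₀ hs).pow _).mul (ContinuousAt.comp (g := csqrt) (continuousAt_csqrt hr)
        B.continuous_prod_one_sub.continuousAt)
    · exact mul_ne_zero (pow_ne_zero _ (inv_ne_zero hs))
          (csqrt_ne_zero (Complex.slitPlane_ne_zero hr))
    · filter_upwards [eventually_ne_nhds hs] with u hu using localParam_infPlus hu
  | infMinus =>
    filter_upwards [self_mem_nhdsWithin, (eventually_prod_one_sub (B := B)).filter_mono
      nhdsWithin_le_nhds] with s hs hr
    have hs : s ≠ 0 := hs
    refine ⟨fun u => u⁻¹, analyticAt_inv hs, by simp [hs],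
      fun t => -(t⁻¹ ^ (g + 1) * csqrt (∏ i, (1 - B.pt i * t))), ?_, ?_, ?_⟩
    · exact (((continuousAt_inv₀ hs).pow _).mul (ContinuousAt.comp (g := csqrt)
        (continuousAt_csqrt hr) B.continuous_prod_one_sub.continuousAt)).neg
    · exact neg_ne_zero.2 (mul_ne_zero (pow_ne_zero _ (inv_ne_zero hs))
          (csqrt_ne_zero (Complex.slitPlane_ne_zero hr)))
    · filter_upwards [eventually_ne_nhds hs] with u hu using localParam_infMinus hu

theorem eventually_localParam_eq_affine (P : Surface B) :
    ∀ᶠ s in 𝓝[≠] (0 : ℂ), ∃ x y h, y ≠ 0 ∧ localParam P s = affine x y h := by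
  filter_upwards [eventually_isRegularCurve P] with s ⟨ξ, H⟩
  exact ⟨ξ s, H.exists_eq⟩

theorem eventually_ord_localParam (F : Surface B → ℂ) (P : Surface B) :
    ∀ᶠ s in 𝓝[≠] (0 : ℂ), meromorphicOrderAt (fun u => F (localParam P u)) s = ord F (localParam P s) := by
  filter_upwards [eventually_isRegularCurve P] with s ⟨ξ, H⟩
  exact H.meromorphicOrderAt F

theorem eventually_ord_eq_top {F : Surface B → ℂ} {P : Surface B} (h : ord F P = ⊤) :
    ∀ᶠ s in 𝓝[≠] (0 : ℂ), ord F (localParam P s) = ⊤ := by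
  have h1 := eventually_eventually_nhdsWithin.2 (meromorphicOrderAt_eq_top_iff.1 h)
  filter_upwards [h1, eventually_ord_localParam F P, self_mem_nhdsWithin] with s h1 h2 hs
  rw [← h2, meromorphicOrderAt_eq_top_iff]
  rw [isOpen_compl_singleton.nhdsWithin_eq hs] at h1
  exact h1.filter_mono nhdsWithin_le_nhds

theorem eventually_ord_eq_zero {F : Surface B → ℂ} (hF : IsMeromorphic F) {P : Surface B}
    (h : ord F P ≠ ⊤) : ∀ᶠ s in 𝓝[≠] (0 : ℂ), ord F (localParam P s) = 0 := by
  filter_upwards [(hF P).eventually_analyticAt, eventually_ord_localParam F P,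
    (meromorphicOrderAt_ne_top_iff_eventually_ne_zero (hF P)).1 h] with s h1 h2 h3
  rw [← h2, h1.meromorphicOrderAt_eq, h1.analyticOrderAt_eq_zero.2 h3]
  rfl

end Surface
end RealBranchPoints

/-! ### The identity theorem and finiteness of zeros and poles -/

namespace RealBranchPoints

variable {g : ℕ} (B : RealBranchPoints g)

namespace Surface

variable {B}

theorem affine_eq_or {x y y' : ℂ} (h : y ^ 2 = B.poly x) (h' : y' ^ 2 = B.poly x) :
    (affine x y' h' : Surface B) = affine x y h ∨
      (affine x y' h' : Surface B) = sheetInterchange (affine x y h) := by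
  rcases sq_eq_sq_iff_eq_or_eq_neg.1 (h'.trans h.symm) with e | e
  · exact Or.inl (affine_congr rfl e)
  · exact Or.inr (affine_congr rfl e)

theorem exists_affine (B : RealBranchPoints g) (x : ℂ) : ∃ y, y ^ 2 = B.poly x :=
  ⟨csqrt (B.poly x), csqrt_sq _⟩

theorem eventually_forall_sq {q : ℂ → Prop} (a : ℂ) (hq : ∀ᶠ s in 𝓝[≠] (0 : ℂ), q s) :
    ∀ᶠ x in 𝓝[≠] a, ∀ s, s ^ 2 = x - a → q s := by
  rw [eventually_nhdsWithin_iff, Metric.eventually_nhds_iff] at hq ⊢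
  obtain ⟨ε, hε, hq⟩ := hq
  refine ⟨ε ^ 2, by positivity, fun x hx hxa s hs => hq ?_ ?_⟩
  · rw [dist_eq_norm, ← hs, norm_pow] at hx
    rw [dist_zero_right]
    exact lt_of_pow_lt_pow_left₀ 2 hε.le hx
  · rintro rfl
    exact hxa (sub_eq_zero.1 (by rw [← hs]; ring))

/-- The charts at the points over `a` cover all points over a punctured neighbourhood of `a`. -/
theorem eventually_forall_affine {p : Surface B → Prop} (a : ℂ)
    (H : ∀ y h, ∀ᶠ s in 𝓝[≠] (0 : ℂ), p (localParam (affine a y h) s)) :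
    ∀ᶠ x in 𝓝[≠] a, ∀ y h, p (affine x y h) := by
  obtain ⟨b, hb⟩ := exists_affine B a
  by_cases hb0 : b = 0
  · filter_upwards [eventually_forall_sq a (H b hb)] with x hx y hy
    -- `μ` is odd in the branch chart, so the two square roots of `x - a` parametrize the two points
    -- over `x`.
    obtain ⟨h1, e1⟩ := localParam_branch hb hb0 (csqrt (x - a))
    obtain ⟨h2, e2⟩ := localParam_branch hb hb0 (-csqrt (x - a))
    have p1 := hx _ (csqrt_sq (x - a))
    have p2 := hx (-csqrt (x - a)) (by rw [neg_sq, csqrt_sq])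
    rw [e1] at p1
    rw [e2] at p2
    have hxa : a + csqrt (x - a) ^ 2 = x := by rw [csqrt_sq]; ring
    simp only [neg_sq, hxa] at p1 p2 h1
    rcases affine_eq_or h1 hy with e | e <;> rw [e]
    · exact p1
    · convert! p2 using 1
      exact affine_congr rfl (by ring)
  · have ht : Tendsto (fun x => x - a) (𝓝[≠] a) (𝓝[≠] 0) := by
      refine tendsto_nhdsWithin_iff.2 ⟨?_, ?_⟩
      · have : ContinuousAt (fun x : ℂ => x - a) a := by fun_prop
        simpa [ContinuousAt] using this.mono_left nhdsWithin_le_nhds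
      · filter_upwards [self_mem_nhdsWithin] with x hx using sub_ne_zero.2 hx
    filter_upwards [ht.eventually (H b hb), ht.eventually (H (-b) (by rw [neg_sq, hb]))]
      with x p1 p2 y hy
    obtain ⟨h1, e1⟩ := localParam_regular hb hb0 (x - a)
    rw [show (affine a (-b) _ : Surface B) = sheetInterchange (affine a b hb) from rfl,
      localParam_sheetInterchange hb hb0] at p2
    rw [e1] at p1 p2
    have hxa : a + (x - a) = x := by ring
    simp only [hxa] at p1 p2 h1
    rcases affine_eq_or h1 hy with e | e <;> rw [e]
    exacts [p1, p2]

/-- The charts at the points at infinity cover all points outside a compact set. -/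
theorem exists_forall_affine_of_lt_norm {p : Surface B → Prop}
    (H1 : ∀ᶠ s in 𝓝[≠] (0 : ℂ), p (localParam infPlus s))
    (H2 : ∀ᶠ s in 𝓝[≠] (0 : ℂ), p (localParam infMinus s)) :
    ∃ R : ℝ, ∀ x y h, R < ‖x‖ → p (affine x y h) := by
  have H := H1.and H2
  rw [eventually_nhdsWithin_iff, Metric.eventually_nhds_iff] at H
  obtain ⟨ε, hε, H⟩ := H
  refine ⟨ε⁻¹, fun x y hy hx => ?_⟩
  have hx0 : x ≠ 0 := norm_pos_iff.1 ((inv_pos.2 hε).trans hx)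
  obtain ⟨p1, p2⟩ := H (y := x⁻¹) (by
    rw [dist_zero_right, norm_inv]
    exact inv_lt_of_inv_lt₀ hε hx) (inv_ne_zero hx0)
  obtain ⟨h1, e1⟩ := localParam_infPlus (B := B) (inv_ne_zero hx0)
  obtain ⟨h2, e2⟩ := localParam_infMinus (B := B) (inv_ne_zero hx0)
  rw [e1] at p1
  rw [e2] at p2
  simp only [inv_inv] at p1 p2 h1
  rcases affine_eq_or h1 hy with e | e <;> rw [e]
  exacts [p1, p2]

/-- By isolation of zeros and poles, the locus where `F` vanishes identically is both open and
closed, as seen in charts. -/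
theorem eventually_ord_eq_top_iff {F : Surface B → ℂ} (hF : IsMeromorphic F) (P : Surface B) :
    ∀ᶠ s in 𝓝 (0 : ℂ), (ord F (localParam P s) = ⊤ ↔ ord F P = ⊤) := by
  have h : ∀ᶠ s in 𝓝[≠] (0 : ℂ), (ord F (localParam P s) = ⊤ ↔ ord F P = ⊤) := by
    by_cases hP : ord F P = ⊤
    · filter_upwards [eventually_ord_eq_top hP] with s hs
      simp [hs, hP]
    · filter_upwards [eventually_ord_eq_zero hF hP] with s hs
      simp [hs, hP]
  rw [eventually_nhdsWithin_iff] at h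
  filter_upwards [h] with s hs
  by_cases h0 : s = 0
  · rw [h0, localParam_zero]
  · exact hs h0

/-- Away from the branch points, a locally constant property of points of the surface is fulfilled by
the same number of sheets everywhere. -/
theorem sheets_eq_of_locally_constant {T : Surface B → Prop}
    (hT : ∀ P, ∀ᶠ s in 𝓝 (0 : ℂ), (T (localParam P s) ↔ T P)) {a x : ℂ} (ha : B.poly a ≠ 0)
    (hx : B.poly x ≠ 0) :
    ((∃ y h, T (affine a y h)) ↔ ∃ y h, T (affine x y h)) ∧
      ((∀ y h, T (affine a y h)) ↔ ∀ y h, T (affine x y h)) := by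
  have hset : {x | B.poly x ≠ 0} = (Set.range B.pt)ᶜ := by
    ext x
    simp [B.poly_eq_zero_iff]
  have hpre : IsPreconnected {x | B.poly x ≠ 0} := by
    rw [hset]
    exact ((Set.finite_range B.pt).countable.isConnected_compl_of_one_lt_rank
      (by rw [Complex.rank_real_complex]; norm_num)).isPreconnected
  refine hpre.induction₂ (fun a x => ((∃ y h, T (affine a y h)) ↔ ∃ y h, T (affine x y h)) ∧
      ((∀ y h, T (affine a y h)) ↔ ∀ y h, T (affine x y h))) ?_ ?_ ?_ ha hx
  · intro a ha
    refine Eventually.filter_mono nhdsWithin_le_nhds ?_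
    obtain ⟨b, hb⟩ := exists_affine B a
    have hb0 : b ≠ 0 := by
      rintro rfl
      exact ha (by rw [← hb]; ring)
    have hex : ∀ {x y} (h : y ^ 2 = B.poly x), (∃ y h, T (affine x y h)) ↔
        (T (affine x y h) ∨ T (sheetInterchange (affine x y h))) := by
      intro x y h
      constructor
      · rintro ⟨y', h', H⟩
        rcases affine_eq_or h h' with e | e <;> rw [e] at H
        exacts [Or.inl H, Or.inr H]
      · rintro (H | H)
        exacts [⟨_, _, H⟩, ⟨_, _, H⟩]
    have hall : ∀ {x y} (h : y ^ 2 = B.poly x), (∀ y h, T (affine x y h)) ↔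
        (T (affine x y h) ∧ T (sheetInterchange (affine x y h))) := by
      intro x y h
      constructor
      · exact fun H => ⟨H _ _, H _ _⟩
      · rintro ⟨H1, H2⟩ y' h'
        rcases affine_eq_or h h' with e | e <;> rw [e]
        exacts [H1, H2]
    have ht : Tendsto (fun x => x - a) (𝓝 a) (𝓝 0) := by
      have : ContinuousAt (fun x : ℂ => x - a) a := by fun_prop
      simpa [ContinuousAt] using this
    filter_upwards [ht.eventually (hT (affine a b hb)),
      ht.eventually (hT (sheetInterchange (affine a b hb)))] with x h1 h2
    rw [localParam_sheetInterchange hb hb0] at h2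
    obtain ⟨h', e⟩ := localParam_regular hb hb0 (x - a)
    rw [e] at h1 h2
    have hxa : a + (x - a) = x := by ring
    simp only [hxa] at h1 h2 h'
    rw [hex hb, hex h', hall hb, hall h', h1, h2]
    exact ⟨Iff.rfl, Iff.rfl⟩
  · rintro x y z - - - ⟨h1, h2⟩ ⟨h3, h4⟩
    exact ⟨h1.trans h3, h2.trans h4⟩
  · rintro x y - - ⟨h1, h2⟩
    exact ⟨h1.symm, h2.symm⟩

/-- The identity theorem. -/
theorem ord_eq_top_iff {F : Surface B → ℂ} (hF : IsMeromorphic F) (P Q : Surface B) :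
    ord F P = ⊤ ↔ ord F Q = ⊤ := by
  -- The base point is a branch point: it is alone in its fibre, so both sheets near it share its
  -- status. This is where connectedness of the double cover enters.
  have hB : B.poly (B.pt 0) = 0 := (B.poly_eq_zero_iff _).2 ⟨0, rfl⟩
  have h0 : (0 : ℂ) ^ 2 = B.poly (B.pt 0) := by rw [hB]; ring
  set O : Surface B := affine (B.pt 0) 0 h0
  have hT := eventually_ord_eq_top_iff hF
  have hnear : ∀ᶠ x in 𝓝[≠] (B.pt 0), ∀ y h, (ord F (affine x y h) = ⊤ ↔ ord F O = ⊤) := by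
    refine eventually_forall_affine (p := fun P => ord F P = ⊤ ↔ ord F O = ⊤) (B.pt 0) ?_
    intro y h
    have hy : y = 0 := by simpa [hB] using h
    subst hy
    exact (hT O).filter_mono nhdsWithin_le_nhds
  have hreg : ∀ᶠ x in 𝓝[≠] (B.pt 0), ∀ y h, ∃ x' y' h', y' ≠ 0 ∧
      (affine x y h : Surface B) = affine x' y' h' :=
    eventually_forall_affine (p := fun P => ∃ x' y' h', y' ≠ 0 ∧ P = affine x' y' h') (B.pt 0)
      fun y h => eventually_localParam_eq_affine _
  obtain ⟨x₁, hx₁, hx₁'⟩ := (hnear.and hreg).exists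
  obtain ⟨y₁, hy₁⟩ := exists_affine B x₁
  have hp₁ : B.poly x₁ ≠ 0 := by
    obtain ⟨x', y', h', hy', e⟩ := hx₁' y₁ hy₁
    injection e with e1 e2
    subst e1
    exact poly_ne_zero_of_ne h' hy'
  have hall : ∀ x y h, y ≠ 0 → (ord F (affine x y h : Surface B) = ⊤ ↔ ord F O = ⊤) := by
    intro x y h hy
    obtain ⟨h1, h2⟩ := sheets_eq_of_locally_constant (T := fun P => ord F P = ⊤) hT hp₁ (poly_ne_zero_of_ne h hy)
    constructor
    -- Vanishing on some sheet is carried back to `x₁`, and vanishing on all sheets is carried from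
    -- `x₁` to `x`; near the branch point the two notions coincide.
    · intro H
      obtain ⟨y', h', H'⟩ := h1.2 ⟨y, h, H⟩
      exact (hx₁ y' h').1 H'
    · intro H
      exact h2.1 (fun y' h' => (hx₁ y' h').2 H) y h
  have key : ∀ P, ord F P = ⊤ ↔ ord F O = ⊤ := by
    intro P
    obtain ⟨s, ⟨x, y, h, hy, e⟩, h2⟩ := ((eventually_localParam_eq_affine P).and
      ((hT P).filter_mono nhdsWithin_le_nhds)).exists
    rw [← h2, e]
    exact hall x y h hy
  rw [key P, key Q]

theorem finite_affine_fiber (x : ℂ) : {P : Surface B | ∃ y h, P = affine x y h}.Finite := by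
  obtain ⟨y, h⟩ := exists_affine B x
  refine (Set.toFinite {affine x y h, sheetInterchange (affine x y h)}).subset ?_
  rintro P ⟨y', h', rfl⟩
  exact affine_eq_or h h'

/-- A meromorphic function that is not identically zero has finitely many zeros and poles. -/
theorem finite_ord_ne_zero {F : Surface B → ℂ} (hF : IsMeromorphic F) (hne : ∀ P, ord F P ≠ ⊤) :
    {P | ord F P ≠ 0}.Finite := by
  obtain ⟨R, hR⟩ := exists_forall_affine_of_lt_norm (p := fun P => ord F P = 0)
    (eventually_ord_eq_zero hF (hne infPlus)) (eventually_ord_eq_zero hF (hne infMinus))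
  set S : Set ℂ := {x | ∃ y h, ord F (affine x y h : Surface B) ≠ 0}
  -- Infinitely many such `x` in a closed disc would accumulate at some `a`, but the charts over `a`
  -- give order zero on the whole fibre over every nearby `x ≠ a`.
  have hS : S.Finite := by
    by_contra hinf
    have hsub : S ⊆ Metric.closedBall 0 R := by
      rintro x ⟨y, h, hx⟩
      rw [mem_closedBall_zero_iff]
      by_contra hlt
      exact hx (hR x y h (not_le.1 hlt))
    obtain ⟨a, -, ha⟩ := Set.Infinite.exists_accPt_of_subset_isCompact hinf
      (isCompact_closedBall (0 : ℂ) R) hsub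
    rw [accPt_iff_frequently_nhdsNE] at ha
    refine ha ?_
    filter_upwards [eventually_forall_affine (p := fun P => ord F P = 0) a
      fun y h => eventually_ord_eq_zero hF (hne _)] with x hx
    rintro ⟨y, h, hxy⟩
    exact hxy (hx y h)
  refine ((Set.toFinite {infPlus, infMinus}).union
    (hS.biUnion fun x _ => finite_affine_fiber (B := B) x)).subset ?_
  intro P hP
  cases P with
  | affine x y h =>
    refine Or.inr (Set.mem_biUnion (x := x) ⟨y, h, hP⟩ ⟨y, h, rfl⟩)
  | infPlus => simp
  | infMinus => simp

end Surface
end RealBranchPoints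

/-! ### Conjugation of meromorphic functions and the involution `ιτ` -/

theorem AnalyticAt.conj_conj_zero {f : ℂ → ℂ} (hf : AnalyticAt ℂ f 0) :
    AnalyticAt ℂ (fun t => (starRingEnd ℂ) (f ((starRingEnd ℂ) t))) 0 := by
  rw [Complex.analyticAt_iff_eventually_differentiableAt] at hf ⊢
  have ht : Tendsto (starRingEnd ℂ) (𝓝 0) (𝓝 0) := by
    simpa using Complex.continuous_conj.tendsto 0
  filter_upwards [ht.eventually hf] with t h
  simpa [Function.comp_def] using h.conj_conj

theorem tendsto_conj_nhdsNE_zero : Tendsto (starRingEnd ℂ) (𝓝[≠] 0) (𝓝[≠] 0) := by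
  refine tendsto_nhdsWithin_iff.2 ⟨?_, ?_⟩
  · have : Tendsto (starRingEnd ℂ) (𝓝 0) (𝓝 0) := by
      simpa using Complex.continuous_conj.tendsto 0
    exact this.mono_left nhdsWithin_le_nhds
  · filter_upwards [self_mem_nhdsWithin] with x hx
    simpa using hx

theorem MeromorphicAt.conj_conj_zero {f : ℂ → ℂ} (hf : MeromorphicAt f 0) :
    MeromorphicAt (fun t => (starRingEnd ℂ) (f ((starRingEnd ℂ) t))) 0 := by
  obtain ⟨n, hn⟩ := hf
  refine ⟨n, ?_⟩
  simpa [AnalyticAt] using hn.conj_conj_zero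

theorem meromorphicOrderAt_conj_conj_zero {f : ℂ → ℂ} (hf : MeromorphicAt f 0) :
    meromorphicOrderAt (fun t => (starRingEnd ℂ) (f ((starRingEnd ℂ) t))) 0 =
      meromorphicOrderAt f 0 := by
  cases h : meromorphicOrderAt f 0 with
  | top =>
    rw [meromorphicOrderAt_eq_top_iff] at h ⊢
    filter_upwards [tendsto_conj_nhdsNE_zero.eventually h] with t ht
    simp [ht]
  | coe n =>
    rw [meromorphicOrderAt_eq_int_iff hf] at h
    rw [meromorphicOrderAt_eq_int_iff hf.conj_conj_zero]
    obtain ⟨k, hk, hk0, hfk⟩ := h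
    refine ⟨_, hk.conj_conj_zero, by simpa using hk0, ?_⟩
    filter_upwards [tendsto_conj_nhdsNE_zero.eventually hfk] with t ht
    simp [ht]

namespace RealBranchPoints

variable {g : ℕ} (B : RealBranchPoints g)

theorem prod_pt_conj (f : ℂ → ℂ) : ∏ i, f ((starRingEnd ℂ) (B.pt i)) = ∏ i, f (B.pt i) := by
  choose s hs using B.conj_mem
  have hinj : Function.Injective s := by
    intro i j hij
    apply B.pt_injective
    apply (starRingEnd ℂ).injective
    rw [← hs i, ← hs j, hij]
  rw [← (Finite.injective_iff_bijective.1 hinj).prod_comp fun i => f (B.pt i)]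
  simp [hs]

theorem cofactor_conj (a x : ℂ) : B.cofactor ((starRingEnd ℂ) a) ((starRingEnd ℂ) x) =
    (starRingEnd ℂ) (B.cofactor a x) := by
  classical
  unfold cofactor
  rw [Finset.prod_filter, Finset.prod_filter, map_prod, ← B.prod_pt_conj fun z =>
    if z ≠ (starRingEnd ℂ) a then (starRingEnd ℂ) x - z else 1]
  refine Finset.prod_congr rfl fun i _ => ?_
  by_cases h : B.pt i = a <;> simp [h, (starRingEnd ℂ).injective.eq_iff]

theorem prod_one_sub_conj (t : ℂ) : ∏ i, (1 - B.pt i * (starRingEnd ℂ) t) =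
    (starRingEnd ℂ) (∏ i, (1 - B.pt i * t)) := by
  rw [← B.prod_pt_conj fun z => 1 - z * (starRingEnd ℂ) t, map_prod]
  simp

namespace Surface

variable {B}

/-- The anti-holomorphic involution `ι ∘ τ`. -/
def iotaTauPt (P : Surface B) : Surface B := sheetInterchange (complexConj P)

theorem iotaTauPt_iotaTauPt (P : Surface B) : iotaTauPt (iotaTauPt P) = P := by
  cases P <;> simp [iotaTauPt, sheetInterchange, complexConj]

theorem iotaTauPt_injective : Function.Injective (iotaTauPt : Surface B → Surface B) :=
  Function.LeftInverse.injective iotaTauPt_iotaTauPt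

theorem iotaTauPt_affine {x y : ℂ} (h : y ^ 2 = B.poly x) : ∃ h',
    iotaTauPt (affine x y h : Surface B) =
      affine ((starRingEnd ℂ) x) (-(starRingEnd ℂ) y) h' :=
  ⟨_, rfl⟩

/-- `ι ∘ τ` is complex conjugation in the local parameters, up to a sign. -/
theorem eventually_iotaTauPt_localParam (P : Surface B) : ∃ ε : ℂ, ε ≠ 0 ∧
    (starRingEnd ℂ) ε = ε ∧
    ∀ᶠ t in 𝓝[≠] (0 : ℂ), iotaTauPt (localParam P t) =
      localParam (iotaTauPt P) ((starRingEnd ℂ) (ε * t)) := by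
  cases P with
  | affine a b h =>
    obtain ⟨h₁, e₁⟩ := iotaTauPt_affine h
    rw [e₁]
    by_cases hb : b = 0
    · have hsq : csqrt (B.cofactor ((starRingEnd ℂ) a) ((starRingEnd ℂ) a)) ^ 2 =
          ((starRingEnd ℂ) (csqrt (B.cofactor a a))) ^ 2 := by
        rw [csqrt_sq, ← map_pow, csqrt_sq, B.cofactor_conj]
      -- `csqrt` need not commute with conjugation on its cut, so the chosen roots at `a` and `conj
      -- a` match only up to sign. That sign and the one from `ι` are absorbed by `t ↦ ε * t`, which
      -- leaves `t ^ 2`, and so `λ`, unchanged.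
      obtain ⟨ε, hε0, hε, hε1, hεc⟩ : ∃ ε : ℂ, ε ≠ 0 ∧ (starRingEnd ℂ) ε = ε ∧ ε ^ 2 = 1 ∧
          ε * csqrt (B.cofactor ((starRingEnd ℂ) a) ((starRingEnd ℂ) a)) =
            -(starRingEnd ℂ) (csqrt (B.cofactor a a)) := by
        rcases sq_eq_sq_iff_eq_or_eq_neg.1 hsq with e | e
        · exact ⟨-1, by norm_num, by simp, by norm_num, by rw [e]; ring⟩
        · exact ⟨1, by norm_num, by simp, by norm_num, by rw [e]; ring⟩
      refine ⟨ε, hε0, hε, Eventually.filter_mono nhdsWithin_le_nhds ?_⟩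
      filter_upwards [eventually_cofactor_ratio (B := B) a] with t ht
      obtain ⟨h₂, e₂⟩ := localParam_branch h hb t
      obtain ⟨h₃, e₃⟩ := localParam_branch h₁ (by simp [hb]) ((starRingEnd ℂ) (ε * t))
      obtain ⟨h₄, e₄⟩ := iotaTauPt_affine h₂
      rw [e₂, e₃, e₄]
      have hx : (starRingEnd ℂ) a + (starRingEnd ℂ) (ε * t) ^ 2 = (starRingEnd ℂ) (a + t ^ 2) := by
        rw [← map_pow, mul_pow, hε1, one_mul, map_add]
      refine affine_congr hx.symm ?_
      have hr : csqrt (B.cofactor ((starRingEnd ℂ) a) ((starRingEnd ℂ) (a + t ^ 2)) /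
          B.cofactor ((starRingEnd ℂ) a) ((starRingEnd ℂ) a)) =
          (starRingEnd ℂ) (csqrt (B.cofactor a (a + t ^ 2) / B.cofactor a a)) := by
        rw [B.cofactor_conj a (a + t ^ 2), B.cofactor_conj a a, ← map_div₀, csqrt_conj ht]
      rw [hx, hr]
      simp only [map_mul, hε]
      linear_combination -((starRingEnd ℂ) t *
        (starRingEnd ℂ) (csqrt (B.cofactor a (a + t ^ 2) / B.cofactor a a))) * hεc
    · refine ⟨1, one_ne_zero, map_one _, Eventually.filter_mono nhdsWithin_le_nhds ?_⟩
      filter_upwards [eventually_poly_ratio (poly_ne_zero_of_ne h hb)] with t ht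
      rw [one_mul]
      obtain ⟨h₂, e₂⟩ := localParam_regular h hb t
      obtain ⟨h₃, e₃⟩ := localParam_regular h₁ (by simpa using hb) ((starRingEnd ℂ) t)
      obtain ⟨h₄, e₄⟩ := iotaTauPt_affine h₂
      rw [e₂, e₃, e₄]
      refine affine_congr (map_add _ _ _) ?_
      rw [← map_add, B.poly_conj, B.poly_conj, ← map_div₀, csqrt_conj ht, map_mul, neg_mul]
  | infPlus =>
    refine ⟨1, one_ne_zero, map_one _, ?_⟩
    filter_upwards [self_mem_nhdsWithin, (eventually_prod_one_sub (B := B)).filter_mono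
      nhdsWithin_le_nhds] with t ht hr
    have ht : t ≠ 0 := ht
    rw [one_mul]
    obtain ⟨h₂, e₂⟩ := localParam_infPlus (B := B) ht
    obtain ⟨h₃, e₃⟩ := localParam_infMinus (B := B) (t := (starRingEnd ℂ) t) (by simpa using ht)
    obtain ⟨h₄, e₄⟩ := iotaTauPt_affine h₂
    rw [e₂, show iotaTauPt (infPlus : Surface B) = infMinus from rfl, e₃, e₄]
    refine affine_congr (map_inv₀ _ _) ?_
    rw [B.prod_one_sub_conj, csqrt_conj hr, map_mul, map_pow, map_inv₀]
  | infMinus =>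
    refine ⟨1, one_ne_zero, map_one _, ?_⟩
    filter_upwards [self_mem_nhdsWithin, (eventually_prod_one_sub (B := B)).filter_mono
      nhdsWithin_le_nhds] with t ht hr
    have ht : t ≠ 0 := ht
    rw [one_mul]
    obtain ⟨h₂, e₂⟩ := localParam_infMinus (B := B) ht
    obtain ⟨h₃, e₃⟩ := localParam_infPlus (B := B) (t := (starRingEnd ℂ) t) (by simpa using ht)
    obtain ⟨h₄, e₄⟩ := iotaTauPt_affine h₂
    rw [e₂, show iotaTauPt (infMinus : Surface B) = infPlus from rfl, e₃, e₄]
    refine affine_congr (map_inv₀ _ _) ?_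
    rw [B.prod_one_sub_conj, csqrt_conj hr, map_neg, neg_neg, map_mul, map_pow, map_inv₀]

/-- The pull-back of a function under `ι ∘ τ`, conjugated so as to be meromorphic again. -/
noncomputable def iotaTauPullback (F : Surface B → ℂ) (P : Surface B) : ℂ :=
  (starRingEnd ℂ) (F (iotaTauPt P))

theorem exists_iotaTauPullback_localParam (F : Surface B → ℂ) (P : Surface B) :
    ∃ ε : ℂ, ε ≠ 0 ∧ (fun t => iotaTauPullback F (localParam P t)) =ᶠ[𝓝[≠] 0]
      (fun t => (starRingEnd ℂ) (F (localParam (iotaTauPt P) ((starRingEnd ℂ) t)))) ∘ (ε * ·) := by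
  obtain ⟨ε, h0, -, h⟩ := eventually_iotaTauPt_localParam P
  refine ⟨ε, h0, ?_⟩
  filter_upwards [h] with t ht
  simp [iotaTauPullback, ht]

theorem IsMeromorphic.iotaTauPullback {F : Surface B → ℂ} (hF : IsMeromorphic F) :
    IsMeromorphic (iotaTauPullback F) := by
  intro P
  obtain ⟨ε, -, h⟩ := exists_iotaTauPullback_localParam F P
  refine MeromorphicAt.congr (MeromorphicAt.comp_analyticAt ?_ (by fun_prop)) h.symm
  simpa using (hF (iotaTauPt P)).conj_conj_zero

theorem ord_iotaTauPullback {F : Surface B → ℂ} (hF : IsMeromorphic F) (P : Surface B) :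
    ord (Surface.iotaTauPullback F) P = ord F (iotaTauPt P) := by
  obtain ⟨ε, h0, h⟩ := exists_iotaTauPullback_localParam F P
  have hd : deriv (fun t : ℂ => ε * t) 0 ≠ 0 := by simpa [deriv_const_mul_field] using h0
  rw [ord, meromorphicOrderAt_congr h, meromorphicOrderAt_comp_of_deriv_ne_zero (by fun_prop) hd,
    mul_zero]
  exact meromorphicOrderAt_conj_conj_zero (hF (iotaTauPt P))

end Surface

/-! ### Linear equivalence and its invariance under `ιτ` -/

open Surface

namespace Divisor

variable {B}

theorem LinEquiv.symm {D E : Divisor B} (h : LinEquiv D E) : LinEquiv E D := by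
  obtain ⟨F, hF, ho⟩ := h
  refine ⟨fun P => (F P)⁻¹, fun P => (hF P).inv, fun P => ?_⟩
  refine (meromorphicOrderAt_inv (f := fun t => F (localParam P t))).trans ?_
  have h := ho P
  rw [ord] at h
  rw [h, ← neg_sub E D]
  simp

theorem LinEquiv.trans {D E E' : Divisor B} (h : LinEquiv D E) (h' : LinEquiv E E') :
    LinEquiv D E' := by
  obtain ⟨F, hF, hFo⟩ := h
  obtain ⟨G, hG, hGo⟩ := h'
  refine ⟨fun P => F P * G P, fun P => (hF P).mul (hG P), fun P => ?_⟩
  refine (meromorphicOrderAt_mul (hF P) (hG P)).trans ?_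
  have h1 := hFo P
  have h2 := hGo P
  rw [ord] at h1 h2
  rw [h1, h2, ← WithTop.coe_add]
  simp

theorem LinEquiv.add_right {D E : Divisor B} (h : LinEquiv D E) (K : Divisor B) :
    LinEquiv (D + K) (E + K) := by
  unfold LinEquiv
  rwa [add_sub_add_right_eq_sub]

theorem iotaTau_apply (D : Divisor B) (P : Surface B) : iotaTau D P = D (iotaTauPt P) := by
  have h := Finsupp.mapDomain_apply (iotaTauPt_injective (B := B)) D (iotaTauPt P)
  rwa [iotaTauPt_iotaTauPt] at h

theorem iotaTau_nonneg {D : Divisor B} (h : 0 ≤ D) : 0 ≤ iotaTau D := fun P => by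
  rw [iotaTau_apply]; exact h _

theorem iotaTau_add (D E : Divisor B) : iotaTau (D + E) = iotaTau D + iotaTau E :=
  Finsupp.mapDomain_add

theorem iotaTau_atInfPlus : iotaTau (atInfPlus B) = atInfMinus B :=
  Finsupp.mapDomain_single

theorem LinEquiv.iotaTau {D E : Divisor B} (h : LinEquiv D E) :
    LinEquiv (iotaTau D) (iotaTau E) := by
  obtain ⟨F, hF, ho⟩ := h
  refine ⟨_, hF.iotaTauPullback, fun P => ?_⟩
  rw [ord_iotaTauPullback hF, ho]
  simp [iotaTau_apply]

end Divisor
end RealBranchPoints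

/-! ### Existence and uniqueness of positive representatives -/

/-- Two meromorphic functions without pole at a point have a nontrivial linear combination that
vanishes there. -/
theorem exists_meromorphicOrderAt_pos {u v : ℂ → ℂ} {x : ℂ} (hu : MeromorphicAt u x)
    (hv : MeromorphicAt v x) (hu0 : 0 ≤ meromorphicOrderAt u x) (hv0 : 0 ≤ meromorphicOrderAt v x) :
    ∃ a b : ℂ, (a ≠ 0 ∨ b ≠ 0) ∧ 0 < meromorphicOrderAt (fun t => a * u t + b * v t) x := by
  obtain ⟨c, hc⟩ := tendsto_nhds_of_meromorphicOrderAt_nonneg hu hu0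
  obtain ⟨d, hd⟩ := tendsto_nhds_of_meromorphicOrderAt_nonneg hv hv0
  have key : ∀ a b : ℂ, a * c + b * d = 0 →
      0 < meromorphicOrderAt (fun t => a * u t + b * v t) x := by
    intro a b h
    refine (tendsto_zero_iff_meromorphicOrderAt_pos ?_).1 ?_
    · exact ((MeromorphicAt.const a x).mul hu).add ((MeromorphicAt.const b x).mul hv)
    · rw [← h]
      exact (hc.const_mul a).add (hd.const_mul b)
  by_cases hd0 : d = 0
  · exact ⟨0, 1, Or.inr one_ne_zero, key 0 1 (by rw [hd0]; ring)⟩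
  · exact ⟨d, -c, Or.inl hd0, key d (-c) (by ring)⟩

namespace RealBranchPoints

open Surface

namespace Divisor

variable {g : ℕ} {B : RealBranchPoints g}

theorem notMem_negligible_of_ord_ne_top {F : Surface B → ℂ} {P : Surface B} (h : ord F P ≠ ⊤) :
    F ∉ negligible B := fun hF => h (meromorphicOrderAt_eq_top_iff.2 (hF P))

/-- The identity theorem makes every order of `F` finite and finiteness makes `(F)` a divisor; then
`E = D + (F)`. -/
theorem exists_nonneg_linEquiv {D : Divisor B} {F : Surface B → ℂ} (hF : F ∈ functionSpace D)
    (hF0 : F ∉ negligible B) : ∃ E : Divisor B, 0 ≤ E ∧ LinEquiv E D := by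
  obtain ⟨hm, hD⟩ := hF
  have hne : ∀ P, ord F P ≠ ⊤ := by
    intro P hP
    exact hF0 fun Q => meromorphicOrderAt_eq_top_iff.1 ((ord_eq_top_iff hm P Q).1 hP)
  have hfin : (Function.support fun P => (ord F P).untop₀).Finite := by
    refine (finite_ord_ne_zero hm hne).subset fun P hP h0 => hP ?_
    simp [h0]
  set K : Divisor B := Finsupp.ofSupportFinite _ hfin
  have hK : ∀ P, ((K P : ℤ) : WithTop ℤ) = ord F P := fun P =>
    WithTop.coe_untop₀_of_ne_top (hne P)
  refine ⟨D + K, fun P => ?_, F, hm, fun P => ?_⟩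
  · have h := hD P
    rw [← hK, WithTop.coe_le_coe] at h
    rw [Finsupp.add_apply, Finsupp.zero_apply]
    linarith
  · rw [add_sub_cancel_left, hK]

/-- Because `D P = 0`, neither function has a pole at `P`, so evaluation at `P` is a single linear
condition on the pair of coefficients. -/
theorem exists_mem_functionSpace_sub_single {D : Divisor B} {P : Surface B} (hP : D P = 0)
    {F G : Surface B → ℂ} (hF : F ∈ functionSpace D) (hG : G ∈ functionSpace D) :
    ∃ a b : ℂ, (a ≠ 0 ∨ b ≠ 0) ∧ a • F + b • G ∈ functionSpace (D - Finsupp.single P 1) := by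
  classical
  have h0 : ∀ {H : Surface B → ℂ}, H ∈ functionSpace D → 0 ≤ ord H P := by
    intro H hH
    have := hH.2 P
    rwa [hP] at this
  obtain ⟨a, b, hab, hpos⟩ := exists_meromorphicOrderAt_pos (hF.1 P) (hG.1 P) (h0 hF) (h0 hG)
  have hmem : a • F + b • G ∈ functionSpace D :=
    add_mem (Submodule.smul_mem _ _ hF) (Submodule.smul_mem _ _ hG)
  refine ⟨a, b, hab, hmem.1, fun Q => ?_⟩
  by_cases hQ : Q = P
  · subst hQ
    have hpos : 0 < ord (a • F + b • G) Q := hpos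
    have e : -((D - Finsupp.single Q 1 : Divisor B) Q) = 1 := by simp [hP]
    rw [e]
    cases h : ord (a • F + b • G) Q with
    | top => exact le_top
    | coe n =>
      rw [h] at hpos
      have : (0 : ℤ) < n := by exact_mod_cast hpos
      exact_mod_cast this
  · have e : (D - Finsupp.single P 1 : Divisor B) Q = D Q := by
      rw [Finsupp.sub_apply, Finsupp.single_apply, if_neg (Ne.symm hQ), sub_zero]
    rw [e]
    exact hmem.2 Q

theorem exists_independent_of_ell_eq_two {D : Divisor B} (h : D.ell = 2) :
    ∃ F ∈ functionSpace D, ∃ G ∈ functionSpace D,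
      ∀ a b : ℂ, a • F + b • G ∈ negligible B → a = 0 ∧ b = 0 := by
  unfold ell at h
  -- `finrank` is `0` in infinite dimension, so the value `2` itself forces finiteness.
  have : Module.Finite ℂ ((functionSpace D).map (negligible B).mkQ) :=
    Module.finite_of_finrank_pos (by rw [h]; norm_num)
  have b := Module.finBasisOfFinrankEq ℂ _ h
  obtain ⟨F, hF, eF⟩ := (b 0).2
  obtain ⟨G, hG, eG⟩ := (b 1).2
  refine ⟨F, hF, G, hG, fun s t hst => ?_⟩
  have hli := b.linearIndependent
  rw [Fintype.linearIndependent_iff] at hli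
  have hz : ∑ i, (![s, t] : Fin 2 → ℂ) i • b i = 0 := by
    apply Subtype.ext
    simp only [Fin.sum_univ_two, Matrix.cons_val_zero, Matrix.cons_val_one, Submodule.coe_add,
      Submodule.coe_smul, ← eF, ← eG, Submodule.coe_zero]
    rw [← map_smul, ← map_smul, ← map_add, Submodule.mkQ_apply, Submodule.Quotient.mk_eq_zero]
    exact hst
  exact ⟨hli _ hz 0, hli _ hz 1⟩

theorem exists_nonneg_linEquiv_sub_single {D : Divisor B} (h : D.ell = 2) {P : Surface B}
    (hP : D P = 0) : ∃ E : Divisor B, 0 ≤ E ∧ LinEquiv E (D - Finsupp.single P 1) := by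
  obtain ⟨F, hF, G, hG, hind⟩ := exists_independent_of_ell_eq_two h
  obtain ⟨a, b, hab, hH⟩ := exists_mem_functionSpace_sub_single hP hF hG
  refine exists_nonneg_linEquiv hH fun hn => ?_
  obtain ⟨ha, hb⟩ := hind a b hn
  exact hab.elim (fun h => h ha) fun h => h hb

/-- Functions realizing `E₁` and `E₂` have a nontrivial combination in the space of `D - P`. The
hypothesis on `D - P` makes it negligible, so the functions are proportional and have equal orders.
-/
theorem eq_of_linEquiv {D : Divisor B} {P : Surface B} (hP : D P = 0)
    (hD : ¬ ∃ E : Divisor B, 0 ≤ E ∧ LinEquiv E (D - Finsupp.single P 1)) {E₁ E₂ : Divisor B}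
    (h₁ : 0 ≤ E₁) (h₂ : 0 ≤ E₂) (e₁ : LinEquiv E₁ D) (e₂ : LinEquiv E₂ D) : E₁ = E₂ := by
  have hmem : ∀ {E : Divisor B} {F : Surface B → ℂ}, 0 ≤ E → IsMeromorphic F →
      (∀ Q, ord F Q = (((E - D) Q : ℤ) : WithTop ℤ)) → F ∈ functionSpace D := by
    intro E F hE hF ho
    refine ⟨hF, fun Q => ?_⟩
    rw [ho, WithTop.coe_le_coe, Finsupp.sub_apply]
    have : 0 ≤ E Q := hE Q
    linarith
  have htop : ∀ {E : Divisor B} {F : Surface B → ℂ},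
      (∀ Q, ord F Q = (((E - D) Q : ℤ) : WithTop ℤ)) → F ∉ negligible B := fun ho =>
    notMem_negligible_of_ord_ne_top (P := P) (by rw [ho]; exact WithTop.coe_ne_top)
  obtain ⟨F, hF, hFo⟩ := e₁
  obtain ⟨G, hG, hGo⟩ := e₂
  obtain ⟨a, b, hab, hH⟩ := exists_mem_functionSpace_sub_single hP (hmem h₁ hF hFo) (hmem h₂ hG hGo)
  have hneg : a • F + b • G ∈ negligible B := by
    by_contra hn
    exact hD (exists_nonneg_linEquiv hH hn)
  have ha : a ≠ 0 := by
    rintro rfl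
    have hb : b ≠ 0 := hab.resolve_left fun h => h rfl
    rw [zero_smul, zero_add, Submodule.smul_mem_iff _ hb] at hneg
    exact htop hGo hneg
  have hb : b ≠ 0 := by
    rintro rfl
    rw [zero_smul, add_zero, Submodule.smul_mem_iff _ ha] at hneg
    exact htop hFo hneg
  ext Q
  have hord : ord F Q = ord G Q := by
    have hc : (fun t => F (localParam Q t)) =ᶠ[𝓝[≠] 0]
        (fun _ => -b / a) * (fun t => G (localParam Q t)) := by
      filter_upwards [hneg Q] with t ht
      simp only [Pi.add_apply, Pi.smul_apply, smul_eq_mul] at ht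
      simp only [Pi.mul_apply]
      field_simp
      linear_combination ht
    rw [ord, meromorphicOrderAt_congr hc, meromorphicOrderAt_mul_of_ne_zero analyticAt_const
      (div_ne_zero (neg_ne_zero.2 hb) ha)]
    rfl
  rw [hFo, hGo, WithTop.coe_inj, Finsupp.sub_apply, Finsupp.sub_apply] at hord
  linarith

end Divisor

end RealBranchPoints

/-! ### The main theorem -/

open RealBranchPoints RealBranchPoints.Divisor in
theorem mainTheorem9 (g : ℕ) (B : RealBranchPoints g) (D : RealBranchPoints.Divisor B)
    (hdeg : D.degree = g + 1) (hns : D.IsNonspecial)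
    (hplus : D RealBranchPoints.Surface.infPlus = 0)
    (hminus : D RealBranchPoints.Surface.infMinus = 0)
    (hgen : D.GenericityCondition) :
    (∃! Dp : RealBranchPoints.Divisor B, D.IsPlusPart Dp) ∧
    (∃! Dm : RealBranchPoints.Divisor B, D.IsMinusPart Dm) ∧
    ∀ Dp Dm : RealBranchPoints.Divisor B, D.IsPlusPart Dp → D.IsMinusPart Dm →
      (Dm = Dp.iotaTau ↔ D.iotaTau.LinEquiv D) := by
  have hell : D.ell = 2 := by
    have h := hns.2.2
    rw [hdeg] at h
    have : (D.ell : ℤ) = 2 := by rw [h]; ring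
    exact_mod_cast this
  have hgen₁ : ¬ ∃ E : Divisor B, 0 ≤ E ∧ LinEquiv E (D - atInfPlus B - atInfMinus B) :=
    fun ⟨E, hE, h⟩ => hgen ⟨E, hE, h.symm⟩
  have hgen₂ : ¬ ∃ E : Divisor B, 0 ≤ E ∧ LinEquiv E (D - atInfMinus B - atInfPlus B) := by
    rwa [sub_right_comm]
  -- Uniqueness after removing one point at infinity is tested at the other one, where genericity
  -- applies.
  have huniq₁ : ∀ E₁ E₂ : Divisor B, D.IsPlusPart E₁ → D.IsPlusPart E₂ → E₁ = E₂ :=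
    fun E₁ E₂ h₁ h₂ => eq_of_linEquiv (P := Surface.infMinus) (by simp [atInfPlus, hminus]) hgen₁
      h₁.1 h₂.1 h₁.2 h₂.2
  have huniq₂ : ∀ E₁ E₂ : Divisor B, D.IsMinusPart E₁ → D.IsMinusPart E₂ → E₁ = E₂ :=
    fun E₁ E₂ h₁ h₂ => eq_of_linEquiv (P := Surface.infPlus) (by simp [atInfMinus, hplus]) hgen₂
      h₁.1 h₂.1 h₁.2 h₂.2
  refine ⟨?_, ?_, fun Dp Dm hp hm => ?_⟩
  · obtain ⟨E, hE⟩ := exists_nonneg_linEquiv_sub_single hell hplus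
    exact ⟨E, hE, fun E' hE' => huniq₁ _ _ hE' hE⟩
  · obtain ⟨E, hE⟩ := exists_nonneg_linEquiv_sub_single hell hminus
    exact ⟨E, hE, fun E' hE' => huniq₂ _ _ hE' hE⟩
  · have h₁ : LinEquiv (Dp.iotaTau + atInfMinus B) D.iotaTau := by
      have h := (hp.2.add_right (atInfPlus B)).iotaTau
      rwa [sub_add_cancel, iotaTau_add, iotaTau_atInfPlus] at h
    constructor
    · intro h
      have h₂ := hm.2.add_right (atInfMinus B)
      rw [sub_add_cancel, h] at h₂
      exact h₁.symm.trans h₂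
    · intro h
      -- It suffices that `ιτ(D_+)` is another positive divisor equivalent to `D - ∞_-`.
      refine huniq₂ _ _ hm ⟨iotaTau_nonneg hp.1, ?_⟩
      have h₂ := (h₁.trans h).add_right (-atInfMinus B)
      rwa [add_neg_cancel_right, ← sub_eq_add_neg] at h₂
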